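/- Let $[n]=\{1,\dots,n\}$ and let $\binom{[n]}{k}$ be the family of all $k$-element subsets of $[n]$. A family $\mathcal F$ of sets is $r$-wise intersecting if $F_1\cap\dots\cap F_r\ne\emptyset$ for all (not necessarily distinct) $F_1,\dots,F_r\in\mathcal F$. An $(r+1)$-triangle is a collection $\mathcal T$ of exactly $r+1$ distinct sets such that $\bigcap_{T\in\mathcal T}T=\emptyset$, while $T_1\cap\dots\cap T_r\neq\emptyset$ for all $T_1,\dots,T_r\in\mathcal T$. For $X\subseteq[n]$ put $$\mathcal F_{X,k}=\Big\{F\in\tbinom{[n]}{k}:|F\cap X|\ge|X|-1\Big\},\qquad \mathcal F'_{X,k}=\Big\{F\in\tbinom{[n]}{k}:|F\cap X|=|X|-1\Big\},$$ and let $n_{r+1,k}$ be the number of $(r+1)$-triangles $\mathcal T\subseteq\mathcal F_{X,k}$ for a subset $X\subseteq[n]$ with $|X|=r+1$ (this number does not depend on the choice of $X$). Theorem. Let $k\ge r\ge 3$ and $n\ge 4k^{r(r+1)}$, and let $\mathcal F\subseteq\binom{[n]}{k}$ be $r$-wise intersecting. Then the number of $(r+1)$-triangles $\mathcal T\subseteq\mathcal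 F$ is at most $n_{r+1,k}$, and equality holds if and only if $\mathcal F'_{X,k}\subseteq\mathcal F\subseteq\mathcal F_{X,k}$ for some $X\subseteq[n]$ with $|X|=r+1$. -/

import Mathlib

/-- `F` is `r`-wise intersecting: any `r` (not necessarily distinct) members of `F` have a
common element. -/
def RWiseIntersecting {α : Type*} (r : ℕ) (F : Finset (Finset α)) : Prop :=
  ∀ A : Fin r → Finset α, (∀ i, A i ∈ F) → ∃ x, ∀ i, x ∈ A i

/-- `T` is an `m`-triangle (`m ≥ 2`): it consists of `m` sets without a common element, and any
`m - 1` members of `T` have a common element. -/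
def IsTriangle {α : Type*} (m : ℕ) (T : Finset (Finset α)) : Prop :=
  T.card = m ∧
  (∀ A : Fin (m - 1) → Finset α, (∀ i, A i ∈ T) → ∃ x, ∀ i, x ∈ A i) ∧
  ¬ ∃ x, ∀ A ∈ T, x ∈ A

open scoped Classical in
/-- The number of `m`-triangles contained in the family `F`. -/
noncomputable def triangleCount {α : Type*} (m : ℕ) (F : Finset (Finset α)) : ℕ :=
  (F.powerset.filter (fun T => IsTriangle m T)).card

/-- The family `F_{X,k}` of all `k`-subsets `A` of `[n]` with `|A ∩ X| ≥ |X| - 1`. -/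
def famX {n : ℕ} (X : Finset (Fin n)) (k : ℕ) : Finset (Finset (Fin n)) :=
  (Finset.powersetCard k Finset.univ).filter (fun A => X.card ≤ (A ∩ X).card + 1)

/-- The family `F'_{X,k}` of all `k`-subsets `A` of `[n]` with `|A ∩ X| = |X| - 1`. -/
def famX' {n : ℕ} (X : Finset (Fin n)) (k : ℕ) : Finset (Finset (Fin n)) :=
  (Finset.powersetCard k Finset.univ).filter (fun A => (A ∩ X).card + 1 = X.card)

/-- The number `n_{m,k}` of `m`-triangles in `F_{X,k}`, where `X` is an `m`-subset of `[n]`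
(`m ≤ n`); here `X` consists of the first `m` elements, and `extremalCount_eq` shows that any other
`m`-subset gives the same number. -/
noncomputable def extremalCount (n m k : ℕ) : ℕ :=
  triangleCount m (famX (Finset.univ.filter (fun i : Fin n => i.val < m)) k)

theorem IsTriangle.map {α : Type*} (e : Equiv.Perm α) {m : ℕ} {T : Finset (Finset α)}
    (h : IsTriangle m T) :
    IsTriangle m (T.map (Finset.mapEmbedding e.toEmbedding).toEmbedding) := by
  obtain ⟨h1, h2, h3⟩ := h
  refine ⟨by simpa using h1, ?_, ?_⟩
  · intro A hA
    have hA' : ∀ i, ∃ B ∈ T, B.map e.toEmbedding = A i := by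
      intro i
      simpa using hA i
    choose B hB hBA using hA'
    obtain ⟨x, hx⟩ := h2 B hB
    refine ⟨e x, fun i => ?_⟩
    rw [← hBA i]
    simpa using hx i
  · rintro ⟨x, hx⟩
    refine h3 ⟨e.symm x, fun B hB => ?_⟩
    have := hx (B.map e.toEmbedding) (Finset.mem_map.2 ⟨B, hB, rfl⟩)
    simpa [Finset.mem_map_equiv] using this

theorem triangleCount_famX_le {n : ℕ} (m k : ℕ) (X Y : Finset (Fin n)) (h : X.card = Y.card) :
    triangleCount m (famX X k) ≤ triangleCount m (famX Y k) := by
  classical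
  obtain ⟨e, he⟩ : ∃ e : Equiv.Perm (Fin n), X.map e.toEmbedding = Y := by
    let f : {x // x ∈ X} ≃ {x // x ∈ Y} := Finset.equivOfCardEq h
    refine ⟨f.extendSubtype, Finset.eq_of_subset_of_card_le ?_ (by simp [h])⟩
    intro y hy
    obtain ⟨x, hx, rfl⟩ := Finset.mem_map.1 hy
    exact f.extendSubtype_mem x hx
  unfold triangleCount
  refine Finset.card_le_card_of_injOn
    (fun T => T.map (Finset.mapEmbedding e.toEmbedding).toEmbedding) ?_
    (fun S _ T _ hST => Finset.map_injective _ hST)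
  intro T hT
  simp only [Finset.coe_filter, Finset.mem_powerset, Set.mem_ofPred_eq] at hT ⊢
  refine ⟨?_, hT.2.map e⟩
  intro A hA
  obtain ⟨B, hB, rfl⟩ := Finset.mem_map.1 hA
  have hB' := hT.1 hB
  simp only [famX, Finset.mem_filter, Finset.mem_powersetCard, Finset.subset_univ,
    true_and] at hB' ⊢
  refine ⟨by simpa using hB'.1, ?_⟩
  have hi : (B.map e.toEmbedding ∩ Y).card = (B ∩ X).card := by
    rw [← he, ← Finset.map_inter, Finset.card_map]
  have := hB'.2
  change Y.card ≤ (B.map e.toEmbedding ∩ Y).card + 1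
  omega

/-- The number of `m`-triangles in `F_{X,k}` is the same for all `m`-subsets `X` of `[n]`. -/
theorem extremalCount_eq {n m : ℕ} (k : ℕ) (X : Finset (Fin n)) (hX : X.card = m) :
    triangleCount m (famX X k) = extremalCount n m k := by
  have hmn : m ≤ n := by
    have := Finset.card_le_univ X
    simp only [Fintype.card_fin] at this
    omega
  have hc : X.card = (Finset.univ.filter (fun i : Fin n => i.val < m)).card := by
    rw [hX, Fin.card_filter_val_lt]
    omega
  exact le_antisymm (triangleCount_famX_le m k _ _ hc) (triangleCount_famX_le m k _ _ hc.symm)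

/-! If `F` lies in some `famX X k`, the bound is monotonicity. Equality is decided by two facts:
triangles in `famX X k` use only members of `famX' X k` (`IsTriangle.subset_famX'`), and every such
member lies in a triangle (`exists_isTriangle_of_mem_famX'`).

Otherwise the count is strictly smaller. Enlarge `F` to a saturated family `G` and consider its
transversals with `r` elements. By `IsSaturated.exists_forall_mem_or` they share a point `x`. A
triangle has no common point, so one of its members contains no such transversal. A branching
argument shows that these members are rare: at most about `k ^ (r + 2) / n` times `N = (n -
r).choose (k - r)`. If `G` has a triangle at all, it has few transversals with `r` elements, so
`G.card ≤ k ^ (r - 1) * N`. Hence `G` has at most `N ^ (r + 1) / 3` triangles for large `n`, whereas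
`famX X k` has at least `N ^ (r + 1) / 2`. -/

/-! ### Transversals and saturated families -/

theorem RWiseIntersecting.exists_common {n r : ℕ} {F : Finset (Finset (Fin n))}
    (h : RWiseIntersecting r F) {S : Finset (Finset (Fin n))} (hS : S ⊆ F)
    (hne : S.Nonempty) (hc : S.card ≤ r) : ∃ x, ∀ A ∈ S, x ∈ A := by
  classical
  obtain ⟨A₀, hA₀⟩ := hne
  -- The members of `S` are listed by index; `A₀` fills the remaining places up to `r`.
  obtain ⟨x, hx⟩ := h
    (fun i => if hi : i.val < S.card then (S.equivFin.symm ⟨i.val, hi⟩).1 else A₀) (by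
      intro i
      split_ifs with hi
      · exact hS (S.equivFin.symm ⟨i.val, hi⟩).2
      · exact hS hA₀)
  refine ⟨x, fun A hA => ?_⟩
  have hlt := (S.equivFin ⟨A, hA⟩).2
  have := hx ⟨S.equivFin ⟨A, hA⟩, hlt.trans_le hc⟩
  simpa [hlt] using this

/-- `B` meets the intersection of any fewer than `r` members of `F`. -/
def IsTransversal {n : ℕ} (r : ℕ) (F : Finset (Finset (Fin n))) (B : Finset (Fin n)) : Prop :=
  ∀ S ⊆ F, S.card + 1 ≤ r → ∃ x ∈ B, ∀ A ∈ S, x ∈ A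

theorem IsTransversal.mono {n r : ℕ} {F : Finset (Finset (Fin n))} {B C : Finset (Fin n)}
    (h : IsTransversal r F B) (hBC : B ⊆ C) : IsTransversal r F C := fun S hS hc =>
  let ⟨x, hx, hxS⟩ := h S hS hc
  ⟨x, hBC hx, hxS⟩

theorem RWiseIntersecting.isTransversal {n r : ℕ} {F : Finset (Finset (Fin n))}
    (h : RWiseIntersecting r F) {B : Finset (Fin n)} (hB : B ∈ F) : IsTransversal r F B := by
  intro S hS hc
  obtain ⟨x, hx⟩ := h.exists_common (S := insert B S) (Finset.insert_subset hB hS)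
    (Finset.insert_nonempty _ _) ((Finset.card_insert_le _ _).trans hc)
  exact ⟨x, hx B (Finset.mem_insert_self _ _), fun A hA => hx A (Finset.mem_insert_of_mem hA)⟩

theorem RWiseIntersecting.insert_isTransversal {n r : ℕ} {F : Finset (Finset (Fin n))}
    (h : RWiseIntersecting r F) {B : Finset (Fin n)} (hB : IsTransversal r F B) :
    RWiseIntersecting r (insert B F) := by
  intro A hA
  by_cases hall : ∀ i, A i ∈ F
  · exact h A hall
  · push Not at hall
    obtain ⟨j, hj⟩ := hall
    have hjB : A j = B := (Finset.mem_insert.1 (hA j)).resolve_right hj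
    have hmem : B ∈ Finset.univ.image A := Finset.mem_image.2 ⟨j, Finset.mem_univ _, hjB⟩
    -- All occurrences of `B` count once, so at most `r - 1` members of `F` remain besides it.
    obtain ⟨x, hxB, hx⟩ := hB ((Finset.univ.image A).erase B) (by
      intro C hC
      obtain ⟨hne, hC⟩ := Finset.mem_erase.1 hC
      obtain ⟨i, -, rfl⟩ := Finset.mem_image.1 hC
      exact (Finset.mem_insert.1 (hA i)).resolve_left hne) (by
      rw [Finset.card_erase_add_one hmem]
      exact Finset.card_image_le.trans (by simp))
    refine ⟨x, fun i => ?_⟩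
    by_cases hi : A i = B
    · rwa [hi]
    · exact hx _ (Finset.mem_erase.2 ⟨hi, Finset.mem_image_of_mem _ (Finset.mem_univ _)⟩)

/-- `F` contains every transversal with `k` elements; this holds for the maximal `r`-wise
intersecting families of `k`-sets. -/
def IsSaturated {n : ℕ} (r k : ℕ) (F : Finset (Finset (Fin n))) : Prop :=
  ∀ B : Finset (Fin n), B.card = k → IsTransversal r F B → B ∈ F

theorem RWiseIntersecting.exists_isSaturated {n r k : ℕ} {F : Finset (Finset (Fin n))}
    (h : RWiseIntersecting r F) (hF : F ⊆ Finset.powersetCard k Finset.univ) :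
    ∃ G, F ⊆ G ∧ G ⊆ Finset.powersetCard k Finset.univ ∧ RWiseIntersecting r G ∧
      IsSaturated r k G := by
  obtain ⟨G, hFG, hG⟩ := (Set.toFinite
    {G : Finset (Finset (Fin n)) | G ⊆ Finset.powersetCard k Finset.univ ∧
      RWiseIntersecting r G}).exists_le_maximal (a := F) ⟨hF, h⟩
  refine ⟨G, hFG, hG.prop.1, hG.prop.2, fun B hBk hB => ?_⟩
  exact hG.le_of_ge (y := insert B G)
    ⟨Finset.insert_subset (by simpa using hBk) hG.prop.1, hG.prop.2.insert_isTransversal hB⟩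
    (Finset.subset_insert _ _) (Finset.mem_insert_self _ _)

/-- Fix one transversal `C` and extend each other one `B` to a `k`-set `D` with `D ∩ C = B ∩ C`.
Saturation puts these `D` into `F`, so `C` meets their intersection, and a common point in `C`
already lies in every `B`. -/
theorem IsSaturated.exists_common {n r k : ℕ} {F : Finset (Finset (Fin n))}
    (hs : IsSaturated r k F) (hn : 2 * k ≤ n)
    {S : Finset (Finset (Fin n))} (hS : ∀ B ∈ S, IsTransversal r F B ∧ B.card ≤ k)
    (hne : S.Nonempty) (hc : S.card ≤ r) : ∃ x, ∀ A ∈ S, x ∈ A := by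
  obtain ⟨C, hC⟩ := hne
  have hext : ∀ B ∈ S, ∃ D ∈ F, B ⊆ D ∧ D ⊆ B ∪ Cᶜ := by
    intro B hB
    obtain ⟨D, h1, h2, h3⟩ := Finset.exists_subsuperset_card_eq
      (s := B) (t := B ∪ Cᶜ) (n := k) Finset.subset_union_left (hS B hB).2 (by
        have h1 := Finset.card_le_card (Finset.subset_union_right (s₁ := B) (s₂ := Cᶜ))
        have h2 := (hS C hC).2
        have h3 : Cᶜ.card = n - C.card := by simp [Finset.card_compl]
        omega)
    exact ⟨D, hs D h3 ((hS B hB).1.mono h1), h1, h2⟩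
  choose! D hDF hBD hDB using hext
  obtain ⟨x, hxC, hx⟩ := (hS C hC).1 ((S.erase C).image D) (by
    intro E hE
    obtain ⟨B, hB, rfl⟩ := Finset.mem_image.1 hE
    exact hDF B (Finset.mem_of_mem_erase hB)) (by
    have := Finset.card_image_le (s := S.erase C) (f := D)
    have := Finset.card_erase_add_one hC
    omega)
  refine ⟨x, fun B hB => ?_⟩
  by_cases hBC : B = C
  · rwa [hBC]
  · have := hDB B hB (hx _ (Finset.mem_image_of_mem _ (Finset.mem_erase.2 ⟨hBC, hB⟩)))
    simpa [hxC] using this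

/-! ### Transversals with `r` elements -/

/-- The transversals with `r` elements have a common element, unless the family is contained in
some `F_{X,k}`. -/
theorem IsSaturated.exists_forall_mem_or {n r k : ℕ} {F : Finset (Finset (Fin n))}
    (hF : F ⊆ Finset.powersetCard k Finset.univ) (hint : RWiseIntersecting r F)
    (hs : IsSaturated r k F) (hn : 2 * k ≤ n) (hr : 2 ≤ r) (hrk : r ≤ k) :
    (∃ x, ∀ B : Finset (Fin n), B.card = r → IsTransversal r F B → x ∈ B) ∨
    ∃ X : Finset (Fin n), X.card = r + 1 ∧ F ⊆ famX X k := by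
  by_cases hcom : ∃ x, ∀ B : Finset (Fin n), B.card = r → IsTransversal r F B → x ∈ B
  · exact Or.inl hcom
  right
  push Not at hcom
  obtain ⟨B, hBr, hB, -⟩ := hcom ⟨0, by omega⟩
  choose C hCr hC hbC using hcom
  -- `C d` misses `d`, so the only possible common point of `B` and the sets `C d` with `d ≠ b` is
  -- `b`.
  have key : ∀ b ∈ B, ∀ c ∈ B, c ≠ b → b ∈ C c := by
    intro b hb c hc hcb
    obtain ⟨x, hx⟩ := hs.exists_common hn (S := insert B ((B.erase b).image C)) (by
      intro D hD
      rcases Finset.mem_insert.1 hD with rfl | hD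
      · exact ⟨hB, by omega⟩
      · obtain ⟨d, -, rfl⟩ := Finset.mem_image.1 hD
        exact ⟨hC d, by have := hCr d; omega⟩) (Finset.insert_nonempty _ _) (by
      have h1 := Finset.card_insert_le B ((B.erase b).image C)
      have h2 := Finset.card_image_le (s := B.erase b) (f := C)
      have h3 := Finset.card_erase_add_one hb
      omega)
    have hxB : x ∈ B := hx B (Finset.mem_insert_self _ _)
    have hmem : ∀ d ∈ B, d ≠ b → x ∈ C d := fun d hd hdb =>
      hx _ (Finset.mem_insert_of_mem
        (Finset.mem_image_of_mem _ (Finset.mem_erase.2 ⟨hdb, hd⟩)))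
    have hxb : x = b := by
      by_contra hne
      exact hbC x (hmem x hxB hne)
    rw [← hxb]
    exact hmem c hc hcb
  have hBne : B.Nonempty := Finset.card_pos.1 (by omega)
  -- The common point `y` lies outside `B`, which forces `C b = insert y (B.erase b)`: all
  -- `r`-subsets of `insert y B` are transversals.
  obtain ⟨y, hy⟩ := hs.exists_common hn (S := B.image C) (by
      intro D hD
      obtain ⟨d, -, rfl⟩ := Finset.mem_image.1 hD
      exact ⟨hC d, by have := hCr d; omega⟩) (hBne.image _)
      (Finset.card_image_le.trans hBr.le)
  have hyC : ∀ b ∈ B, y ∈ C b := fun b hb => hy _ (Finset.mem_image_of_mem _ hb)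
  have hyB : y ∉ B := fun h => hbC y (hyC y h)
  have hXcard : (insert y B).card = r + 1 := by rw [Finset.card_insert_of_notMem hyB, hBr]
  have hXtr : ∀ x ∈ insert y B, IsTransversal r F ((insert y B).erase x) := by
    intro x hx
    rcases Finset.mem_insert.1 hx with rfl | hx'
    · rwa [Finset.erase_insert hyB]
    · have heq : (insert y B).erase x = C x := by
        refine Finset.eq_of_subset_of_card_le ?_ ?_
        · intro z hz
          obtain ⟨hzx, hz⟩ := Finset.mem_erase.1 hz
          rcases Finset.mem_insert.1 hz with rfl | hz
          · exact hyC x hx'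
          · exact key z hz x hx' (Ne.symm hzx)
        · rw [hCr, Finset.card_erase_of_mem hx, hXcard, Nat.add_sub_cancel]
      rw [heq]
      exact hC x
  refine ⟨insert y B, hXcard, fun A hA => ?_⟩
  have hAk : A.card = k := (Finset.mem_powersetCard.1 (hF hA)).2
  simp only [famX, Finset.mem_filter]
  refine ⟨hF hA, ?_⟩
  by_contra hlt
  set X := insert y B with hXdef
  have h2 : 1 < (X \ A).card := by
    have := Finset.card_sdiff_add_card_inter X A
    rw [Finset.inter_comm] at this
    omega
  obtain ⟨p, hp, q, hq, hpq⟩ := Finset.one_lt_card.1 h2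
  obtain ⟨hpX, hpA⟩ := Finset.mem_sdiff.1 hp
  obtain ⟨hqX, hqA⟩ := Finset.mem_sdiff.1 hq
  have hpe : p ∈ X.erase q := Finset.mem_erase.2 ⟨hpq, hpX⟩
  -- If `A` missed two points `p`, `q` of `X`, then `A` and the `r - 1` sets `X.erase c` with `c ≠
  -- p, q` would be `r` transversals without a common point.
  obtain ⟨x, hx⟩ := hs.exists_common hn
    (S := insert A (((X.erase q).erase p).image (fun c => X.erase c))) (by
      intro D hD
      rcases Finset.mem_insert.1 hD with rfl | hD
      · exact ⟨hint.isTransversal hA, hAk.le⟩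
      · obtain ⟨d, hd, rfl⟩ := Finset.mem_image.1 hD
        have hdX : d ∈ X := Finset.mem_of_mem_erase (Finset.mem_of_mem_erase hd)
        refine ⟨hXtr d hdX, ?_⟩
        rw [Finset.card_erase_of_mem hdX]
        omega) (Finset.insert_nonempty _ _) (by
      have h1 := Finset.card_insert_le A (((X.erase q).erase p).image (fun c => X.erase c))
      have h3 := Finset.card_image_le (s := (X.erase q).erase p) (f := fun c => X.erase c)
      have h4 := Finset.card_erase_add_one hpe
      have h5 := Finset.card_erase_add_one hqX
      omega)
  have hxA : x ∈ A := hx A (Finset.mem_insert_self _ _)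
  have hmem : ∀ c ∈ X, c ≠ q → c ≠ p → x ∈ X.erase c := fun c hc hcq hcp =>
    hx _ (Finset.mem_insert_of_mem (Finset.mem_image_of_mem _
      (Finset.mem_erase.2 ⟨hcp, Finset.mem_erase.2 ⟨hcq, hc⟩⟩)))
  have hxp : x ≠ p := fun h => hpA (h ▸ hxA)
  have hxq : x ≠ q := fun h => hqA (h ▸ hxA)
  obtain ⟨c, hc⟩ : ((X.erase q).erase p).Nonempty := Finset.card_pos.1 (by
    have h4 := Finset.card_erase_add_one hpe
    have h5 := Finset.card_erase_add_one hqX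
    omega)
  have hxX : x ∈ X := by
    obtain ⟨hcp, hc⟩ := Finset.mem_erase.1 hc
    obtain ⟨hcq, hc⟩ := Finset.mem_erase.1 hc
    exact Finset.mem_of_mem_erase (hmem c hc hcq hcp)
  exact (Finset.mem_erase.1 (hmem x hxX hxq hxp)).1 rfl

/-! ### Upper bounds from transversals -/

theorem card_filter_superset_le {n k : ℕ} (D : Finset (Fin n)) :
    ((Finset.powersetCard k Finset.univ).filter (fun A => D ⊆ A)).card ≤
      (n - D.card).choose (k - D.card) := by
  have h : (Finset.powersetCard (k - D.card) Dᶜ).card = (n - D.card).choose (k - D.card) := by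
    rw [Finset.card_powersetCard, Finset.card_compl, Fintype.card_fin]
  rw [← h]
  refine Finset.card_le_card_of_injOn (fun A => A \ D) ?_ ?_
  · intro A hA
    obtain ⟨hA, hD⟩ := Finset.mem_filter.1 hA
    refine Finset.mem_coe.2 (Finset.mem_powersetCard.2 ⟨?_, ?_⟩)
    · intro x hx
      exact Finset.mem_compl.2 (Finset.mem_sdiff.1 hx).2
    · rw [Finset.card_sdiff_of_subset hD, (Finset.mem_powersetCard.1 hA).2]
  · intro A hA B hB hAB
    have hA' := (Finset.mem_filter.1 hA).2
    have hB' := (Finset.mem_filter.1 hB).2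
    dsimp only at hAB
    rw [← Finset.sdiff_union_of_subset hA', hAB, Finset.sdiff_union_of_subset hB']

open scoped Classical in
/-- The members of `F` that contain no transversal with `r` elements. -/
noncomputable def nonTransversalPart {n : ℕ} (r : ℕ) (F : Finset (Finset (Fin n))) :
    Finset (Finset (Fin n)) :=
  F.filter (fun A => ¬ ∃ B ⊆ A, B.card = r ∧ IsTransversal r F B)

theorem nonTransversalPart_eq_empty {n r : ℕ} {F : Finset (Finset (Fin n))}
    (hF : F ⊆ Finset.powersetCard r Finset.univ) (hint : RWiseIntersecting r F) :
    nonTransversalPart r F = ∅ := by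
  classical
  refine Finset.filter_eq_empty_iff.2 fun A hA h => h ⟨A, subset_rfl, ?_, hint.isTransversal hA⟩
  exact (Finset.mem_powersetCard.1 (hF hA)).2

/-- Branching: a set `D` of at most `r` elements inside such a member is not a transversal, so it is
disjoint from the intersection `I` of fewer than `r` members. Every member meets `I`, and `I` has at
most `k` points, so `D` grows by one point in at most `k` ways. -/
theorem card_filter_superset_nonTransversalPart_le {n k r : ℕ} {F : Finset (Finset (Fin n))}
    (hF : F ⊆ Finset.powersetCard k Finset.univ) (hint : RWiseIntersecting r F)
    (hr : 2 ≤ r) (hrk : r ≤ k) (j : ℕ) :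
    ∀ D : Finset (Fin n), D.card + j = r + 1 →
      ((nonTransversalPart r F).filter (fun A => D ⊆ A)).card ≤
        k ^ j * (n - (r + 1)).choose (k - (r + 1)) := by
  classical
  have hsub : nonTransversalPart r F ⊆ F := Finset.filter_subset _ _
  induction j with
  | zero =>
    intro D hD
    have hD' : D.card = r + 1 := by simpa using hD
    rw [pow_zero, one_mul, ← hD']
    exact (Finset.card_le_card (Finset.filter_subset_filter _ (hsub.trans hF))).trans
      (card_filter_superset_le D)
  | succ j ih =>
    intro D hD
    rcases ((nonTransversalPart r F).filter (fun A => D ⊆ A)).eq_empty_or_nonempty with h0 | ⟨A₀, hA₀⟩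
    · rw [h0]; simp
    obtain ⟨hA₀', hDA₀⟩ := Finset.mem_filter.1 hA₀
    obtain ⟨hA₀F, hA₀T⟩ := Finset.mem_filter.1 hA₀'
    have hDtr : ¬ IsTransversal r F D := by
      intro hDt
      obtain ⟨B, h1, h2, h3⟩ := Finset.exists_subsuperset_card_eq (n := r) hDA₀ (by omega) (by
        rw [(Finset.mem_powersetCard.1 (hF hA₀F)).2]; exact hrk)
      exact hA₀T ⟨B, h2, h3, hDt.mono h1⟩
    obtain ⟨S, hSF, hSc, hSne, hS⟩ : ∃ S ⊆ F, S.card + 1 ≤ r ∧ S.Nonempty ∧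
        ∀ x ∈ D, ∃ A ∈ S, x ∉ A := by
      unfold IsTransversal at hDtr
      push Not at hDtr
      obtain ⟨S, hSF, hSc, hS⟩ := hDtr
      -- An empty `S` forces `D` to be empty; `{A₀}` replaces it so that `I` has at most `k` points.
      rcases S.eq_empty_or_nonempty with rfl | hne
      · refine ⟨{A₀}, by simpa using hA₀F, by simpa using hr, Finset.singleton_nonempty _, ?_⟩
        intro x hx
        simpa using hS x hx
      · exact ⟨S, hSF, hSc, hne, hS⟩
    set I : Finset (Fin n) := Finset.univ.filter (fun x => ∀ A ∈ S, x ∈ A) with hI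
    have hIc : I.card ≤ k := by
      obtain ⟨A, hA⟩ := hSne
      rw [← (Finset.mem_powersetCard.1 (hF (hSF hA))).2]
      exact Finset.card_le_card fun x hx => (Finset.mem_filter.1 hx).2 A hA
    have hcover : (nonTransversalPart r F).filter (fun A => D ⊆ A) ⊆
        I.biUnion (fun x => (nonTransversalPart r F).filter (fun A => insert x D ⊆ A)) := by
      intro A hA
      obtain ⟨hA', hDA⟩ := Finset.mem_filter.1 hA
      obtain ⟨x, hxA, hx⟩ := hint.isTransversal (hsub hA') S hSF hSc
      exact Finset.mem_biUnion.2 ⟨x, Finset.mem_filter.2 ⟨Finset.mem_univ _, hx⟩,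
        Finset.mem_filter.2 ⟨hA', Finset.insert_subset hxA hDA⟩⟩
    refine (Finset.card_le_card hcover).trans ?_
    refine (Finset.card_biUnion_le_card_mul _ _ (k ^ j * (n - (r + 1)).choose (k - (r + 1))) ?_).trans ?_
    · intro x hx
      refine ih _ ?_
      have hxD : x ∉ D := by
        intro hxD
        obtain ⟨A, hA, hxA⟩ := hS x hxD
        exact hxA ((Finset.mem_filter.1 hx).2 A hA)
      rw [Finset.card_insert_of_notMem hxD]
      omega
    · rw [pow_succ', mul_assoc]
      exact Nat.mul_le_mul_right _ hIc

theorem card_nonTransversalPart_mul_le {n k r : ℕ} {F : Finset (Finset (Fin n))}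
    (hF : F ⊆ Finset.powersetCard k Finset.univ) (hint : RWiseIntersecting r F)
    (hr : 2 ≤ r) (hrk : r ≤ k) (hkn : k ≤ n) :
    (nonTransversalPart r F).card * (n - r) ≤
      k ^ (r + 1) * ((k - r) * (n - r).choose (k - r)) := by
  -- For `k = r` the truncated `k - (r + 1)` makes the branching bound too weak, but then every
  -- member is itself a transversal.
  rcases hrk.eq_or_lt with rfl | hlt
  · rw [nonTransversalPart_eq_empty hF hint]; simp
  have h := card_filter_superset_nonTransversalPart_le hF hint hr hrk (r + 1) ∅ (by simp)
  simp only [Finset.empty_subset, Finset.filter_true] at h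
  obtain ⟨a, rfl⟩ := Nat.exists_eq_add_of_lt hlt
  obtain ⟨b, rfl⟩ := Nat.exists_eq_add_of_lt (hlt.trans_le hkn)
  have e1 : r + b + 1 - (r + 1) = b := by omega
  have e2 : r + a + 1 - (r + 1) = a := by omega
  have e3 : r + b + 1 - r = b + 1 := by omega
  have e4 : r + a + 1 - r = a + 1 := by omega
  rw [e1, e2] at h
  rw [e3, e4]
  have hc := Nat.add_one_mul_choose_eq b a
  calc _ ≤ (r + a + 1) ^ (r + 1) * b.choose a * (b + 1) := Nat.mul_le_mul_right _ h
    _ = (r + a + 1) ^ (r + 1) * ((b + 1) * b.choose a) := by ring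
    _ = _ := by rw [hc]; ring

-- Each such `B` is `x` together with `r - 1` points of `A₀`. Otherwise `B ∩ A₀` has at most `r - 2`
-- points, and `A₀` with one member missing each of them gives at most `r - 1` members whose
-- intersection avoids `B`.
open scoped Classical in
theorem card_filter_isTransversal_le {n k r : ℕ} {F : Finset (Finset (Fin n))}
    {x : Fin n}
    (hx : ∀ B : Finset (Fin n), B.card = r → IsTransversal r F B → x ∈ B)
    {A₀ : Finset (Fin n)} (hA₀ : A₀ ∈ F) (hA₀k : A₀.card = k) (hxA₀ : x ∉ A₀)
    (hmiss : ∀ b, ∃ A ∈ F, b ∉ A) :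
    ((Finset.powersetCard r Finset.univ).filter (IsTransversal r F)).card ≤
      k.choose (r - 1) := by
  choose C hCF hC using hmiss
  have key : ∀ B ∈ (Finset.powersetCard r Finset.univ).filter (IsTransversal r F),
      x ∈ B ∧ B.erase x ⊆ A₀ ∧ B.card = r := by
    intro B hB
    obtain ⟨hB, hBt⟩ := Finset.mem_filter.1 hB
    have hBr := (Finset.mem_powersetCard.1 hB).2
    have hxB := hx B hBr hBt
    refine ⟨hxB, ?_, hBr⟩
    have hsub : B ∩ A₀ ⊆ B.erase x := by
      intro y hy
      obtain ⟨hyB, hyA⟩ := Finset.mem_inter.1 hy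
      exact Finset.mem_erase.2 ⟨fun h => hxA₀ (h ▸ hyA), hyB⟩
    have hcard : (B.erase x).card ≤ (B ∩ A₀).card := by
      by_contra! hlt
      have h1 := Finset.card_erase_add_one hxB
      obtain ⟨y, hyB, hy⟩ := hBt (insert A₀ ((B ∩ A₀).image C)) (by
        intro D hD
        rcases Finset.mem_insert.1 hD with rfl | hD
        · exact hA₀
        · obtain ⟨d, -, rfl⟩ := Finset.mem_image.1 hD
          exact hCF d) (by
        have h2 := Finset.card_insert_le A₀ ((B ∩ A₀).image C)
        have h3 := Finset.card_image_le (s := B ∩ A₀) (f := C)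
        omega)
      have hyA := hy A₀ (Finset.mem_insert_self _ _)
      exact hC y (hy _ (Finset.mem_insert_of_mem
        (Finset.mem_image_of_mem _ (Finset.mem_inter.2 ⟨hyB, hyA⟩))))
    rw [← Finset.eq_of_subset_of_card_le hsub hcard]
    exact Finset.inter_subset_right
  rw [← hA₀k, ← Finset.card_powersetCard]
  refine Finset.card_le_card_of_injOn (fun B => B.erase x) ?_ ?_
  · intro B hB
    obtain ⟨h1, h2, h3⟩ := key B hB
    exact Finset.mem_coe.2 (Finset.mem_powersetCard.2 ⟨h2, by rw [Finset.card_erase_of_mem h1, h3]⟩)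
  · intro B hB C hC hBC
    dsimp only at hBC
    rw [← Finset.insert_erase (key B hB).1, hBC, Finset.insert_erase (key C hC).1]

open scoped Classical in
theorem card_le_transversals_add {n k r : ℕ} {F : Finset (Finset (Fin n))}
    (hF : F ⊆ Finset.powersetCard k Finset.univ) :
    F.card ≤ ((Finset.powersetCard r Finset.univ).filter (IsTransversal r F)).card *
      (n - r).choose (k - r) + (nonTransversalPart r F).card := by
  set T := (Finset.powersetCard r Finset.univ).filter (IsTransversal r F)
  have hcover : F ⊆ (T.biUnion fun B => (Finset.powersetCard k Finset.univ).filter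
      (fun A => B ⊆ A)) ∪ nonTransversalPart r F := by
    intro A hA
    by_cases h : ∃ B ⊆ A, B.card = r ∧ IsTransversal r F B
    · obtain ⟨B, hBA, hBr, hB⟩ := h
      refine Finset.mem_union_left _ (Finset.mem_biUnion.2 ⟨B, ?_, ?_⟩)
      · exact Finset.mem_filter.2 ⟨by simpa using hBr, hB⟩
      · exact Finset.mem_filter.2 ⟨hF hA, hBA⟩
    · exact Finset.mem_union_right _ (Finset.mem_filter.2 ⟨hA, h⟩)
  refine (Finset.card_le_card hcover).trans ((Finset.card_union_le _ _).trans ?_)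
  refine Nat.add_le_add_right (Finset.card_biUnion_le_card_mul _ _ _ fun B hB => ?_) _
  have hBr := (Finset.mem_powersetCard.1 (Finset.mem_filter.1 hB).1).2
  simpa only [hBr] using card_filter_superset_le (k := k) B

/-- If the transversals with `r` elements have a common element, every triangle has a member
that contains none of them. -/
theorem triangleCount_le_of_forall_mem {n r : ℕ} {F : Finset (Finset (Fin n))} {x : Fin n}
    (hx : ∀ B : Finset (Fin n), B.card = r → IsTransversal r F B → x ∈ B) :
    triangleCount (r + 1) F ≤ (nonTransversalPart r F).card * F.card.choose r := by
  classical
  unfold triangleCount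
  rw [← Finset.card_powersetCard, ← Finset.card_product]
  refine (Finset.card_le_card ?_).trans
    (Finset.card_image_le (f := fun p : Finset (Fin n) × Finset (Finset (Fin n)) =>
      insert p.1 p.2))
  intro T hT
  obtain ⟨hTF, hTc, -, hTe⟩ := Finset.mem_filter.1 hT
  rw [Finset.mem_powerset] at hTF
  obtain ⟨A, hAT, hA⟩ : ∃ A ∈ T, A ∈ nonTransversalPart r F := by
    by_contra! h
    refine hTe ⟨x, fun A hA => ?_⟩
    by_contra hxA
    refine h A hA (Finset.mem_filter.2 ⟨hTF hA, ?_⟩)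
    rintro ⟨B, hBA, hBr, hB⟩
    exact hxA (hBA (hx B hBr hB))
  refine Finset.mem_image.2 ⟨(A, T.erase A), ?_, Finset.insert_erase hAT⟩
  refine Finset.mem_product.2 ⟨hA, Finset.mem_powersetCard.2
    ⟨(Finset.erase_subset _ _).trans hTF, ?_⟩⟩
  rw [Finset.card_erase_of_mem hAT, hTc, Nat.add_sub_cancel]

/-! ### Triangles in `famX X k` -/

theorem famX'_subset_famX {n : ℕ} (X : Finset (Fin n)) (k : ℕ) : famX' X k ⊆ famX X k := by
  intro A hA
  obtain ⟨h1, h2⟩ := Finset.mem_filter.1 hA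
  exact Finset.mem_filter.2 ⟨h1, h2.ge⟩

theorem triangleCount_mono {α : Type*} {m : ℕ} {F G : Finset (Finset α)} (h : F ⊆ G) :
    triangleCount m F ≤ triangleCount m G := by
  classical
  exact Finset.card_le_card (Finset.filter_subset_filter _ (Finset.powerset_mono.2 h))

theorem IsTriangle.subset_of_triangleCount_le {α : Type*} {m : ℕ} {F G : Finset (Finset α)}
    (h : F ⊆ G) (hc : triangleCount m G ≤ triangleCount m F) {T : Finset (Finset α)}
    (hT : IsTriangle m T) (hTG : T ⊆ G) : T ⊆ F := by
  classical
  have := Finset.eq_of_subset_of_card_le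
    (Finset.filter_subset_filter (fun T => IsTriangle m T) (Finset.powerset_mono.2 h)) hc
  have hmem : T ∈ G.powerset.filter (fun T => IsTriangle m T) :=
    Finset.mem_filter.2 ⟨Finset.mem_powerset.2 hTG, hT⟩
  rw [← this] at hmem
  exact Finset.mem_powerset.1 (Finset.mem_filter.1 hmem).1

/-- If a member contained `X`, the other `r` members, each missing at most one point of `X`, would
leave a point of `X` common to all. -/
theorem IsTriangle.subset_famX' {n k r : ℕ} {X : Finset (Fin n)} (hX : X.card = r + 1)
    {T : Finset (Finset (Fin n))} (hT : IsTriangle (r + 1) T) (hTX : T ⊆ famX X k) :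
    T ⊆ famX' X k := by
  intro A hA
  obtain ⟨hAk, hAX⟩ := Finset.mem_filter.1 (hTX hA)
  refine Finset.mem_filter.2 ⟨hAk, ?_⟩
  by_contra hne
  have hle := Finset.card_le_card (Finset.inter_subset_right (s₁ := A) (s₂ := X))
  have hXA : X ⊆ A := by
    have : A ∩ X = X := Finset.eq_of_subset_of_card_le Finset.inter_subset_right (by omega)
    rw [← this]; exact Finset.inter_subset_left
  have hcard : ((T.erase A).biUnion fun B => X \ B).card ≤ r := by
    have h1 := Finset.card_biUnion_le_card_mul (T.erase A) (fun B => X \ B) 1 (by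
      intro B hB
      have h2 := (Finset.mem_filter.1 (hTX (Finset.mem_of_mem_erase hB))).2
      have h3 := Finset.card_sdiff_add_card_inter X B
      rw [Finset.inter_comm] at h3
      omega)
    have h2 := Finset.card_erase_add_one hA
    rw [hT.1] at h2
    omega
  obtain ⟨x, hxX, hx⟩ := Finset.exists_mem_notMem_of_card_lt_card
    (s := (T.erase A).biUnion fun B => X \ B) (t := X) (by omega)
  refine hT.2.2 ⟨x, fun B hB => ?_⟩
  by_cases hBA : B = A
  · rw [hBA]; exact hXA hxX
  · by_contra hxB
    exact hx (Finset.mem_biUnion.2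
      ⟨B, Finset.mem_erase.2 ⟨hBA, hB⟩, Finset.mem_sdiff.2 ⟨hxX, hxB⟩⟩)

/-- The family of the sets `X \ {x} ∪ g x` for `x ∈ X`. -/
def triangleOf {n : ℕ} (X : Finset (Fin n)) (g : Fin n → Finset (Fin n)) :
    Finset (Finset (Fin n)) :=
  X.image (fun x => X.erase x ∪ g x)

theorem erase_union_inter {n : ℕ} {X G : Finset (Fin n)} (h : Disjoint G X) (x : Fin n) :
    (X.erase x ∪ G) ∩ X = X.erase x := by
  rw [Finset.union_inter_distrib_right, Finset.disjoint_iff_inter_eq_empty.1 h,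
    Finset.union_empty, Finset.inter_eq_left.2 (Finset.erase_subset _ _)]

theorem erase_union_sdiff {n : ℕ} {X G : Finset (Fin n)} (h : Disjoint G X) (x : Fin n) :
    (X.erase x ∪ G) \ X = G := by
  rw [Finset.union_sdiff_distrib, Finset.sdiff_eq_empty_iff_subset.2 (Finset.erase_subset _ _),
    Finset.empty_union, Finset.sdiff_eq_self_of_disjoint h]

theorem eq_of_erase_union_eq {n : ℕ} {X G H : Finset (Fin n)} (hG : Disjoint G X)
    (hH : Disjoint H X) {x y : Fin n} (hx : x ∈ X) (h : X.erase x ∪ G = X.erase y ∪ H) :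
    x = y ∧ G = H := by
  have h1 : X.erase x = X.erase y := by
    rw [← erase_union_inter hG x, h, erase_union_inter hH]
  have h2 : G = H := by rw [← erase_union_sdiff hG x, h, erase_union_sdiff hH]
  refine ⟨?_, h2⟩
  by_contra hne
  have : x ∈ X.erase y := Finset.mem_erase.2 ⟨hne, hx⟩
  rw [← h1] at this
  exact Finset.notMem_erase _ _ this

/-- Any `r` of the sets together miss at most `r` of the `r + 1` points of `X`; all of them together
miss every point of `X`. -/
theorem isTriangle_triangleOf {n r : ℕ} {X : Finset (Fin n)} (hX : X.card = r + 1)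
    {g : Fin n → Finset (Fin n)} (hg : ∀ x ∈ X, Disjoint (g x) X)
    (hempty : ¬ ∃ y, ∀ x ∈ X, y ∈ g x) : IsTriangle (r + 1) (triangleOf X g) := by
  refine ⟨?_, ?_, ?_⟩
  · rw [triangleOf, Finset.card_image_of_injOn, hX]
    intro x hx y hy hxy
    exact (eq_of_erase_union_eq (hg x hx) (hg y hy) hx hxy).1
  · intro A hA
    have hA' : ∀ i, ∃ x ∈ X, X.erase x ∪ g x = A i := fun i => Finset.mem_image.1 (hA i)
    choose x hxX hxA using hA'
    obtain ⟨y, hyX, hy⟩ := Finset.exists_mem_notMem_of_card_lt_card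
      (s := Finset.univ.image x) (t := X) (by
        have := Finset.card_image_le (s := Finset.univ) (f := x)
        simp only [Finset.card_univ, Fintype.card_fin] at this
        omega)
    refine ⟨y, fun i => ?_⟩
    rw [← hxA i]
    refine Finset.mem_union_left _ (Finset.mem_erase.2 ⟨?_, hyX⟩)
    rintro rfl
    exact hy (Finset.mem_image_of_mem _ (Finset.mem_univ i))
  · rintro ⟨y, hy⟩
    have hy' : ∀ x ∈ X, y ∈ X.erase x ∪ g x := fun x hx => hy _ (Finset.mem_image_of_mem _ hx)
    by_cases hyX : y ∈ X
    · rcases Finset.mem_union.1 (hy' y hyX) with h | h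
      · exact Finset.notMem_erase _ _ h
      · exact Finset.disjoint_left.1 (hg y hyX) h hyX
    · refine hempty ⟨y, fun x hx => ?_⟩
      exact (Finset.mem_union.1 (hy' x hx)).resolve_left
        fun h => hyX (Finset.mem_of_mem_erase h)

theorem triangleOf_subset_famX' {n k r : ℕ} {X : Finset (Fin n)} (hX : X.card = r + 1)
    (hrk : r ≤ k) {g : Fin n → Finset (Fin n)} (hg : ∀ x ∈ X, Disjoint (g x) X)
    (hgc : ∀ x ∈ X, (g x).card = k - r) : triangleOf X g ⊆ famX' X k := by
  intro A hA
  obtain ⟨x, hx, rfl⟩ := Finset.mem_image.1 hA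
  have hc : (X.erase x).card = r := by rw [Finset.card_erase_of_mem hx, hX, Nat.add_sub_cancel]
  refine Finset.mem_filter.2 ⟨Finset.mem_powersetCard.2 ⟨Finset.subset_univ _, ?_⟩, ?_⟩
  · rw [Finset.card_union_of_disjoint, hc, hgc x hx]
    · omega
    · exact ((hg x hx).mono_right (Finset.erase_subset _ _)).symm
  · rw [erase_union_inter (hg x hx), hc, hX]

theorem exists_isTriangle_of_mem_famX' {n k r : ℕ} {X : Finset (Fin n)} (hX : X.card = r + 1)
    (hr : 1 ≤ r) (hrk : r ≤ k) (hn : 2 * k + 1 ≤ n) {A : Finset (Fin n)} (hA : A ∈ famX' X k) :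
    ∃ T, IsTriangle (r + 1) T ∧ T ⊆ famX' X k ∧ A ∈ T := by
  obtain ⟨hAk, hAX⟩ := Finset.mem_filter.1 hA
  have hAk := (Finset.mem_powersetCard.1 hAk).2
  have hsd : (X \ A).card = 1 := by
    have h3 := Finset.card_sdiff_add_card_inter X A
    rw [Finset.inter_comm] at h3
    omega
  obtain ⟨a, ha⟩ := Finset.card_eq_one.1 hsd
  have haX : a ∈ X ∧ a ∉ A := by
    rw [← Finset.mem_sdiff, ha]; exact Finset.mem_singleton_self a
  have hAX' : X.erase a = A ∩ X := by
    rw [Finset.erase_eq, ← ha]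
    ext y
    simp only [Finset.mem_sdiff, Finset.mem_inter]
    tauto
  have hAsd : (A \ X).card = k - r := by
    have := Finset.card_sdiff_add_card_inter A X
    omega
  -- `G` avoids `A`, so using it for all other members leaves no common point outside `X`.
  obtain ⟨G, hG, hGc⟩ := Finset.exists_subset_card_eq (s := (X ∪ A)ᶜ) (n := k - r) (by
    have h1 : (X ∪ A).card = k + 1 := by
      rw [Finset.card_union, Finset.inter_comm]
      omega
    rw [Finset.card_compl, h1, Fintype.card_fin]
    omega)
  have hGX : ∀ y ∈ G, y ∉ X ∧ y ∉ A := by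
    intro y hy
    have := hG hy
    simpa using this
  have hg : ∀ x ∈ X, Disjoint ((fun x => if x = a then A \ X else G) x) X := by
    intro x _
    dsimp only
    split_ifs
    · exact Finset.sdiff_disjoint
    · exact Finset.disjoint_left.2 fun y hy => (hGX y hy).1
  refine ⟨triangleOf X (fun x => if x = a then A \ X else G), isTriangle_triangleOf hX hg ?_,
    triangleOf_subset_famX' hX hrk hg ?_, ?_⟩
  · rintro ⟨y, hy⟩
    have h1 := hy a haX.1
    rw [if_pos rfl] at h1
    obtain ⟨b, hb, hba⟩ := Finset.exists_mem_ne (by omega : 1 < X.card) a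
    have h2 := hy b hb
    rw [if_neg hba] at h2
    exact (hGX y h2).2 (Finset.mem_sdiff.1 h1).1
  · intro x _
    split_ifs
    · exact hAsd
    · exact hGc
  · refine Finset.mem_image.2 ⟨a, haX.1, ?_⟩
    dsimp only
    rw [if_pos rfl, hAX', Finset.union_comm, Finset.sdiff_union_inter]

/-- Fix `a ∈ X`, choose its outer part `G` freely outside `X`, and choose the outer parts of the
other points disjoint from `G`; then no point is common to all. -/
theorem pow_le_triangleCount_famX {n k r : ℕ} {X : Finset (Fin n)} (hX : X.card = r + 1)
    (hr : 1 ≤ r) (hrk : r ≤ k) :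
    (n - k - 1).choose (k - r) ^ (r + 1) ≤ triangleCount (r + 1) (famX X k) := by
  classical
  obtain ⟨a, ha⟩ : X.Nonempty := Finset.card_pos.1 (by omega)
  -- The single value `∅` off `X` makes the choice function recoverable from its triangle.
  let c : Finset (Fin n) → Fin n → Finset (Finset (Fin n)) := fun G x =>
    if x = a then {G} else if x ∈ X then Finset.powersetCard (k - r) (Xᶜ \ G) else {∅}
  have hXc : Xᶜ.card = n - (r + 1) := by rw [Finset.card_compl, hX, Fintype.card_fin]
  have hcard : ∀ G ∈ Finset.powersetCard (k - r) Xᶜ,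
      (Fintype.piFinset (c G)).card = (n - k - 1).choose (k - r) ^ r := by
    intro G hG
    obtain ⟨hGX, hGc⟩ := Finset.mem_powersetCard.1 hG
    have hsd : (Xᶜ \ G).card = n - k - 1 := by
      rw [Finset.card_sdiff_of_subset hGX, hXc, hGc]
      omega
    have h1 : ∀ x, (c G x).card =
        if x ∈ X.erase a then (n - k - 1).choose (k - r) else 1 := by
      intro x
      by_cases hxa : x = a
      · simp [c, hxa]
      · by_cases hxX : x ∈ X
        · simp [c, hxa, hxX, hsd]
        · simp [c, hxa, hxX]
    rw [Fintype.card_piFinset, Finset.prod_congr rfl fun x _ => h1 x, Finset.prod_ite_mem,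
      Finset.univ_inter, Finset.prod_const, Finset.card_erase_of_mem ha, hX, Nat.add_sub_cancel]
  have hlow : (n - k - 1).choose (k - r) ^ (r + 1) ≤
      ((Finset.powersetCard (k - r) Xᶜ).sigma fun G => Fintype.piFinset (c G)).card := by
    rw [Finset.card_sigma, Finset.sum_congr rfl hcard, Finset.sum_const, Finset.card_powersetCard,
      hXc, smul_eq_mul, pow_succ']
    exact Nat.mul_le_mul_right _ (Nat.choose_le_choose _ (by omega))
  have key : ∀ p ∈ (Finset.powersetCard (k - r) Xᶜ).sigma fun G => Fintype.piFinset (c G),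
      p.2 a = p.1 ∧ (∀ x, x ∉ X → p.2 x = ∅) ∧ (∀ x ∈ X, Disjoint (p.2 x) X) ∧
      (∀ x ∈ X, (p.2 x).card = k - r) ∧ ∀ x ∈ X, x ≠ a → Disjoint (p.2 x) p.1 := by
    rintro ⟨G, g⟩ hp
    obtain ⟨hG, hg⟩ := Finset.mem_sigma.1 hp
    obtain ⟨hGX, hGc⟩ := Finset.mem_powersetCard.1 hG
    have hg' := Fintype.mem_piFinset.1 hg
    dsimp only at hg' hGX hGc ⊢
    have e1 : g a = G := by simpa [c] using hg' a
    have e2 : ∀ x ∈ X, x ≠ a → g x ⊆ Xᶜ \ G ∧ (g x).card = k - r := by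
      intro x hx hxa
      simpa only [c, if_neg hxa, if_pos hx, Finset.mem_powersetCard] using hg' x
    refine ⟨e1, ?_, ?_, ?_, ?_⟩
    · intro x hx
      have hxa : x ≠ a := fun h => hx (h ▸ ha)
      simpa only [c, if_neg hxa, if_neg hx, Finset.mem_singleton] using hg' x
    · intro x hx
      by_cases hxa : x = a
      · rw [hxa, e1]
        exact Finset.disjoint_left.2 fun y hy => Finset.mem_compl.1 (hGX hy)
      · exact Finset.disjoint_left.2 fun y hy =>
          Finset.mem_compl.1 (Finset.mem_sdiff.1 ((e2 x hx hxa).1 hy)).1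
    · intro x hx
      by_cases hxa : x = a
      · rw [hxa, e1, hGc]
      · exact (e2 x hx hxa).2
    · intro x hx hxa
      exact Finset.disjoint_left.2 fun y hy => (Finset.mem_sdiff.1 ((e2 x hx hxa).1 hy)).2
  refine hlow.trans ?_
  unfold triangleCount
  refine Finset.card_le_card_of_injOn (fun p => triangleOf X p.2) ?_ ?_
  · intro p hp
    obtain ⟨h1, -, h3, h4, h5⟩ := key p hp
    refine Finset.mem_coe.2 (Finset.mem_filter.2 ⟨Finset.mem_powerset.2
      ((triangleOf_subset_famX' hX hrk h3 h4).trans (famX'_subset_famX X k)),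
      isTriangle_triangleOf hX h3 ?_⟩)
    rintro ⟨y, hy⟩
    obtain ⟨b, hb, hba⟩ := Finset.exists_mem_ne (by omega : 1 < X.card) a
    exact Finset.disjoint_left.1 (h5 b hb hba) (hy b hb) (h1 ▸ hy a ha)
  · intro p hp q hq hpq
    obtain ⟨p1, p2, p3, -, -⟩ := key p hp
    obtain ⟨q1, q2, q3, -, -⟩ := key q hq
    have h : p.2 = q.2 := by
      funext x
      by_cases hx : x ∈ X
      · have hmem : X.erase x ∪ p.2 x ∈ triangleOf X q.2 := by
          have : X.erase x ∪ p.2 x ∈ triangleOf X p.2 := Finset.mem_image_of_mem _ hx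
          rwa [show triangleOf X p.2 = triangleOf X q.2 from hpq] at this
        obtain ⟨y, hy, hxy⟩ := Finset.mem_image.1 hmem
        obtain ⟨rfl, h⟩ := eq_of_erase_union_eq (q3 y hy) (p3 x hx) hy hxy
        exact h.symm
      · rw [p2 x hx, q2 x hx]
    obtain ⟨P, u⟩ := p
    obtain ⟨Q, v⟩ := q
    dsimp only at p1 q1 h
    subst h
    rw [← p1, ← q1]

/-! ### Binomial estimates -/

theorem choose_add_le (a b t : ℕ) :
    (a + t + 1).choose (b + 1) ≤ a.choose (b + 1) + (t + 1) * (a + t).choose b := by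
  induction t with
  | zero => simp [Nat.choose_succ_succ, add_comm]
  | succ t ih =>
    have h1 := Nat.choose_succ_succ' (a + t + 1) b
    have h2 : (a + t).choose b ≤ (a + t + 1).choose b := Nat.choose_le_choose _ (Nat.le_succ _)
    have h3 := Nat.mul_le_mul_left (t + 1) h2
    change (a + t + 1 + 1).choose (b + 1) ≤ _ + (t + 1 + 1) * (a + t + 1).choose b
    rw [add_mul (t + 1) 1]
    omega

/-- Passing from `n - k - 1` to `n - r` takes `k - r + 1` Pascal steps, each adding at most a `(k -
r) / (n - r)` fraction of the final coefficient. -/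
theorem choose_mul_le_add {n k r : ℕ} (hr : 1 ≤ r) (hrk : r ≤ k) (hkn : k < n) :
    (n - r).choose (k - r) * (n - r) ≤
      (n - k - 1).choose (k - r) * (n - r) + k ^ 2 * (n - r).choose (k - r) := by
  rcases hrk.eq_or_lt with rfl | hlt
  · simp
  obtain ⟨b, rfl⟩ := Nat.exists_eq_add_of_lt hlt
  obtain ⟨a, rfl⟩ := Nat.exists_eq_add_of_lt hkn
  have e1 : r + b + 1 - r = b + 1 := by omega
  have e2 : r + b + 1 + a + 1 - r = a + (b + 1) + 1 := by omega
  have e3 : r + b + 1 + a + 1 - (r + b + 1) - 1 = a := by omega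
  rw [e1, e2, e3]
  have h1 := choose_add_le a b (b + 1)
  have h2 := Nat.add_one_mul_choose_eq (a + (b + 1)) b
  set N := (a + (b + 1) + 1).choose (b + 1)
  calc N * (a + (b + 1) + 1)
      ≤ (a.choose (b + 1) + (b + 1 + 1) * (a + (b + 1)).choose b) * (a + (b + 1) + 1) :=
        Nat.mul_le_mul_right _ h1
    _ = a.choose (b + 1) * (a + (b + 1) + 1) + (b + 1 + 1) *
          ((a + (b + 1) + 1) * (a + (b + 1)).choose b) := by ring
    _ = a.choose (b + 1) * (a + (b + 1) + 1) + ((b + 1 + 1) * (b + 1)) * N := by rw [h2]; ring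
    _ ≤ _ := by
      refine Nat.add_le_add_left (Nat.mul_le_mul_right _ ?_) _
      nlinarith

/-- Bernoulli's inequality: `(M / N) ^ s ≥ (1 - c / m) ^ s ≥ 1 - s * c / m ≥ 1 / 2`. -/
theorem pow_le_two_mul_pow {M N m c s : ℕ} (hm : 0 < m) (h : N * m ≤ M * m + c * N)
    (hc : 2 * (s * c) ≤ m) : N ^ s ≤ 2 * M ^ s := by
  rcases Nat.eq_zero_or_pos s with rfl | hs
  · simp
  rcases Nat.eq_zero_or_pos N with rfl | hN
  · simp [hs.ne']
  have hcm : c ≤ m := by nlinarith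
  have hN' : (0 : ℝ) < N := by exact_mod_cast hN
  have hm' : (0 : ℝ) < m := by exact_mod_cast hm
  have h' : (N : ℝ) * m ≤ M * m + c * N := by exact_mod_cast h
  have hc' : 2 * ((s : ℝ) * c) ≤ m := by exact_mod_cast hc
  have hcm' : (c : ℝ) ≤ m := by exact_mod_cast hcm
  have h1 : 1 + -((c : ℝ) / m) ≤ M / N := by
    rw [le_div_iff₀ hN', ← mul_le_mul_iff_left₀ hm']
    have : (1 + -((c : ℝ) / m)) * N * m = N * m - c * N := by field_simp; ring
    rw [this]; linarith
  have h2 := one_add_mul_le_pow (a := -((c : ℝ) / m)) (by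
    have : (c : ℝ) / m ≤ 1 := (div_le_one hm').2 hcm'
    linarith) s
  have h0 : 0 ≤ 1 + -((c : ℝ) / m) := by
    have : (c : ℝ) / m ≤ 1 := (div_le_one hm').2 hcm'
    linarith
  have h3 := pow_le_pow_left₀ h0 h1 s
  have h4 : (s : ℝ) * (c / m) ≤ 1 / 2 := by
    rw [← mul_div_assoc, div_le_iff₀ hm']; linarith
  have h5 : (1 : ℝ) / 2 ≤ (M / N) ^ s := by linarith
  rw [div_pow, le_div_iff₀ (pow_pos hN' s)] at h5
  have : (N : ℝ) ^ s ≤ 2 * M ^ s := by linarith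
  exact_mod_cast this

theorem choose_add_one_le_pow {k s : ℕ} (hs : 2 ≤ s) (hk : 2 ≤ k) : k.choose s + 1 ≤ k ^ s := by
  have h1 : s.factorial * k.choose s ≤ k ^ s := by
    rw [← Nat.descFactorial_eq_factorial_mul_choose]
    exact Nat.descFactorial_le_pow k s
  have h2 : 2 ≤ s.factorial := hs.trans (Nat.self_le_factorial s)
  have h3 : k ^ 1 ≤ k ^ s := Nat.pow_le_pow_right (by omega) (by omega)
  nlinarith

/-! ### Comparison and conclusion -/

theorem triangleCount_lt_of_not_subset_famX {n k r : ℕ} (hr : 3 ≤ r) (hrk : r ≤ k)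
    (hn : 4 * k ^ (r * (r + 1)) ≤ n) {F : Finset (Finset (Fin n))}
    (hF : F ⊆ Finset.powersetCard k Finset.univ) (hint : RWiseIntersecting r F)
    (hX : ∀ X : Finset (Fin n), X.card = r + 1 → ¬ F ⊆ famX X k) :
    triangleCount (r + 1) F < extremalCount n (r + 1) k := by
  classical
  have hk : 3 ≤ k := hr.trans hrk
  have hpow : ∀ i, i ≤ r * (r + 1) → k ^ i ≤ k ^ (r * (r + 1)) := fun i hi =>
    Nat.pow_le_pow_right (by omega) hi
  have hkn : 4 * k ≤ n := by
    have := hpow 1 (by nlinarith)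
    rw [pow_one] at this
    omega
  set m := n - r with hm
  have hm3 : 3 * k ^ (r * (r + 1)) ≤ m := by
    have := hpow 1 (by nlinarith)
    rw [pow_one] at this
    omega
  set N := (n - r).choose (k - r) with hN
  have hNpos : 0 < N := Nat.choose_pos (by omega)
  have hlow : N ^ (r + 1) ≤ 2 * extremalCount n (r + 1) k := by
    obtain ⟨X, -, hXc⟩ := Finset.exists_subset_card_eq (s := (Finset.univ : Finset (Fin n)))
      (n := r + 1) (by rw [Finset.card_univ, Fintype.card_fin]; omega)
    have h1 := pow_le_triangleCount_famX hXc (k := k) (by omega) hrk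
    rw [extremalCount_eq k X hXc] at h1
    have h2 := choose_mul_le_add (n := n) (by omega : 1 ≤ r) hrk (by omega)
    refine (pow_le_two_mul_pow (by omega) h2 ?_).trans (Nat.mul_le_mul_left 2 h1)
    have h3 : k ^ 4 ≤ k ^ (r * (r + 1)) := hpow 4 (by nlinarith)
    have h4 : (r + 1) * k ^ 2 ≤ k ^ 4 := by
      have : k ^ 4 = k ^ 2 * k ^ 2 := by ring
      rw [this]
      exact Nat.mul_le_mul_right _ (by nlinarith)
    omega
  have hpos : 0 < extremalCount n (r + 1) k := by
    have := pow_pos hNpos (r + 1)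
    omega
  obtain ⟨G, hFG, hG, hGint, hGs⟩ := hint.exists_isSaturated hF
  refine (triangleCount_mono hFG).trans_lt ?_
  by_cases hcount : triangleCount (r + 1) G = 0
  · omega
  obtain ⟨x, hx⟩ := (hGs.exists_forall_mem_or hG hGint (by omega) (by omega) hrk).resolve_right
    fun ⟨X, hXc, hGX⟩ => hX X hXc (hFG.trans hGX)
  obtain ⟨T, hT⟩ := Finset.card_pos.1 (Nat.pos_of_ne_zero hcount)
  obtain ⟨hTG, -, -, hTe⟩ := Finset.mem_filter.1 hT
  -- A triangle in `G` has no common point, hence neither has `G`.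
  have hmiss : ∀ b, ∃ A ∈ G, b ∉ A := by
    intro b
    by_contra! h
    exact hTe ⟨b, fun A hA => h A (Finset.mem_powerset.1 hTG hA)⟩
  obtain ⟨A₀, hA₀, hxA₀⟩ := hmiss x
  have h1 := card_nonTransversalPart_mul_le hG hGint (by omega) hrk (by omega)
  have h2 := card_filter_isTransversal_le hx hA₀ (Finset.mem_powersetCard.1 (hG hA₀)).2 hxA₀ hmiss
  have h3 := card_le_transversals_add (r := r) hG
  have h4 := triangleCount_le_of_forall_mem hx
  set p := (nonTransversalPart r G).card
  set t := ((Finset.powersetCard r Finset.univ).filter (IsTransversal r G)).card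
  rw [← hm, ← hN] at h1
  rw [← hN] at h3
  have h1' : p * m ≤ k ^ (r + 2) * N := by
    refine h1.trans ?_
    rw [← mul_assoc, pow_succ k (r + 1)]
    exact Nat.mul_le_mul_right _ (Nat.mul_le_mul_left _ (Nat.sub_le _ _))
  have hkpos : ∀ i, 0 < k ^ i := fun i => pow_pos (by omega) i
  have hpN : p ≤ N := by
    have h5 : k ^ (r + 2) ≤ m := by
      have := hpow (r + 2) (by nlinarith)
      omega
    refine le_of_mul_le_mul_left (a := m) ?_ (by omega)
    rw [mul_comm m p]
    exact h1'.trans (Nat.mul_le_mul_right _ h5)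
  have hGN : G.card ≤ k ^ (r - 1) * N := by
    have h6 := choose_add_one_le_pow (k := k) (s := r - 1) (by omega) (by omega)
    calc G.card ≤ t * N + p := h3
      _ ≤ k.choose (r - 1) * N + N := Nat.add_le_add (Nat.mul_le_mul_right _ h2) hpN
      _ = (k.choose (r - 1) + 1) * N := by ring
      _ ≤ _ := Nat.mul_le_mul_right _ h6
  -- The exponent is `(r + 2) + r * (r - 1) = r ^ 2 + 2`, which is at most `r * (r + 1)`.
  have h7 : triangleCount (r + 1) G * m ≤ k ^ (r ^ 2 + 2) * N ^ (r + 1) := by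
    calc triangleCount (r + 1) G * m ≤ p * G.card.choose r * m := Nat.mul_le_mul_right _ h4
      _ ≤ p * (k ^ (r - 1) * N) ^ r * m := by
        gcongr
        exact (Nat.choose_le_pow _ _).trans (Nat.pow_le_pow_left hGN r)
      _ = (p * m) * (k ^ (r - 1) * N) ^ r := by ring
      _ ≤ (k ^ (r + 2) * N) * (k ^ (r - 1) * N) ^ r := Nat.mul_le_mul_right _ h1'
      _ = k ^ (r ^ 2 + 2) * N ^ (r + 1) := by
        obtain ⟨s, rfl⟩ : ∃ s, r = s + 1 := ⟨r - 1, by omega⟩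
        rw [Nat.add_sub_cancel]
        ring
  have h8 : 3 * k ^ (r ^ 2 + 2) ≤ m := by
    have := hpow (r ^ 2 + 2) (by nlinarith)
    omega
  have h9 : triangleCount (r + 1) G * 3 ≤ N ^ (r + 1) := by
    refine le_of_mul_le_mul_left (a := k ^ (r ^ 2 + 2)) ?_ (hkpos _)
    calc _ = triangleCount (r + 1) G * (3 * k ^ (r ^ 2 + 2)) := by ring
      _ ≤ triangleCount (r + 1) G * m := Nat.mul_le_mul_left _ h8
      _ ≤ _ := h7
  omega

theorem theorem2 (n k r : ℕ) (hr : 3 ≤ r) (hrk : r ≤ k) (hn : 4 * k ^ (r * (r + 1)) ≤ n)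
    (F : Finset (Finset (Fin n))) (hF : F ⊆ Finset.powersetCard k Finset.univ)
    (hint : RWiseIntersecting r F) :
    triangleCount (r + 1) F ≤ extremalCount n (r + 1) k ∧
    (triangleCount (r + 1) F = extremalCount n (r + 1) k ↔
      ∃ X : Finset (Fin n), X.card = r + 1 ∧ famX' X k ⊆ F ∧ F ⊆ famX X k) := by
  by_cases hX : ∃ X : Finset (Fin n), X.card = r + 1 ∧ F ⊆ famX X k
  · obtain ⟨X, hXc, hFX⟩ := hX
    have hle : triangleCount (r + 1) F ≤ extremalCount n (r + 1) k :=
      extremalCount_eq k X hXc ▸ triangleCount_mono hFX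
    refine ⟨hle, fun heq => ⟨X, hXc, fun A hA => ?_, hFX⟩, ?_⟩
    · have hkn : 4 * k ≤ n := by
        have h1 : k ^ 1 ≤ k ^ (r * (r + 1)) := Nat.pow_le_pow_right (by omega) (by nlinarith)
        rw [pow_one] at h1
        omega
      obtain ⟨T, hT, hTX, hAT⟩ :=
        exists_isTriangle_of_mem_famX' hXc (by omega) hrk (by omega) hA
      exact hT.subset_of_triangleCount_le hFX (extremalCount_eq k X hXc ▸ heq.ge)
        (hTX.trans (famX'_subset_famX X k)) hAT
    -- `Y` need not be `X`: all triangles of `famX Y k` lie in `famX' Y k`, hence in `F`.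
    · rintro ⟨Y, hYc, hYF, -⟩
      refine le_antisymm hle ?_
      rw [← extremalCount_eq k Y hYc]
      classical
      refine Finset.card_le_card fun T hT => ?_
      obtain ⟨hTY, hT⟩ := Finset.mem_filter.1 hT
      exact Finset.mem_filter.2 ⟨Finset.mem_powerset.2
        ((hT.subset_famX' hYc (Finset.mem_powerset.1 hTY)).trans hYF), hT⟩
  · have hlt := triangleCount_lt_of_not_subset_famX hr hrk hn hF hint
      fun X hXc hFX => hX ⟨X, hXc, hFX⟩
    exact ⟨hlt.le, fun h => absurd h hlt.ne, fun ⟨X, hXc, _, hFX⟩ => (hX ⟨X, hXc, hFX⟩).elim⟩
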